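/- Let $\mathcal B$ be a unital $C^*$-algebra, $\mathcal C$ a (not necessarily unital) $C^*$-algebra, $E$ a (right) Hilbert $\mathcal B$-module and $F$ a (right) Hilbert $\mathcal C$-module, with inner products linear in the second variable. Write $\mathcal B^a(E)$ for the $C^*$-algebra of adjointable operators on $E$. The extended linking algebra of $E$ is the $C^*$-algebra $\begin{pmatrix}\mathcal B & E^*\\ E & \mathcal B^a(E)\end{pmatrix}\subset\mathcal B^a(\mathcal B\oplus E)$, where $x^*\in E^*$ is the map $y\mapsto\langle x,y\rangle$; similarly for $F$. A map between algebras of adjointable operators is called strict if it sends bounded strictly convergent nets to strictly convergent nets, where the strict topology of $\mathcal B^a(E)$ is that of the multiplier algebra of the compact operators $\mathcal K(E)=\overline{\mathrm{span}}\{xy^*: x,y\in E\}$. Let $\tau\colon\mathcal B\to\mathcal C$ be a completely positive (CP) map. A strict CPH$_0$-dilation of $\tau$ is a strict unital $*$-homomorphism $\vartheta\colon\mathcal B^a(E)\to\mathcal B^a(F)$ such that $E$ is full (that is, $\overline{\mathrm{span}}\,\langle E,E\rangle=\mathcal B$) and such that there is a map $T\colon E\to F$ with $$\tau(\langle x,ax'\rangle)=\langle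 T(x),\vartheta(a)T(x')\rangle\qquad\text{for all }a\in\mathcal B^a(E),\ x,x'\in E.\tag{1}$$ A map $T\colon E\to F$ is a strict CPH$_0$-map if there are a CP-map $\tau'\colon\mathcal B\to\mathcal C$ and a strict unital $*$-homomorphism $\vartheta'\colon\mathcal B^a(E)\to\mathcal B^a(F)$ such that the block-wise map $$\begin{pmatrix}\tau' & T^*\\ T&\vartheta'\end{pmatrix}\colon\begin{pmatrix}\mathcal B & E^*\\ E & \mathcal B^a(E)\end{pmatrix}\to\begin{pmatrix}\mathcal C & F^*\\ F & \mathcal B^a(F)\end{pmatrix},\qquad \begin{pmatrix}b & x^*\\ x' & a\end{pmatrix}\mapsto\begin{pmatrix}\tau'(b) & T(x)^*\\ T(x') & \vartheta'(a)\end{pmatrix},$$ is a (linear and) completely positive map. Theorem. If $\vartheta\colon\mathcal B^a(E)\to\mathcal B^a(F)$ is a strict CPH$_0$-dilation of a CP-map $\tau\colon\mathcal B\to\mathcal C$, then every map $T\colon E\to F$ that satisfies (1) is a strict CPH$_0$-map. More precisely, $\begin{pmatrix}\tau & T^*\\ T&\vartheta\end{pmatrix}$ is completely positive. -/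

import Mathlib

namespace HilbertMod

open Filter Topology MulOpposite
open scoped CStarAlgebra
set_option linter.unusedSectionVars false

/-! ### The algebra of adjointable operators on a Hilbert module -/

section Adjointable

variable (A E : Type*) [NonUnitalCStarAlgebra A] [PartialOrder A] [StarOrderedRing A]
  [NormedAddCommGroup E] [NormedSpace ℂ E] [SMul A E] [CStarModule A E]

variable {A E} in
theorem ext_inner {x y : E} (h : ∀ z : E, inner A z x = inner A z y) : x = y := by
  have h1 : inner A (x - y) (x - y) = 0 := by
    rw [CStarModule.inner_sub_right, h, sub_self]
  exact sub_eq_zero.1 (CStarModule.inner_self.1 h1)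

/-- The bounded operators on `E` that have an adjoint for the `A`-valued inner product. -/
def adjointableSubalgebra : Subalgebra ℂ (E →L[ℂ] E) where
  carrier := {T | ∃ S : E →L[ℂ] E, ∀ x y, inner A (T x) y = inner A x (S y)}
  mul_mem' := by
    rintro T T' ⟨S, hS⟩ ⟨S', hS'⟩
    exact ⟨S' * S, fun x y => by simp [hS, hS']⟩
  add_mem' := by
    rintro T T' ⟨S, hS⟩ ⟨S', hS'⟩
    exact ⟨S + S', fun x y => by simp [hS, hS']⟩
  algebraMap_mem' c :=
    ⟨(starRingEnd ℂ c) • 1, fun x y => by simp [Algebra.algebraMap_eq_smul_one]⟩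

/-- The algebra of adjointable operators on the Hilbert module `E`, with the operator norm. -/
def Adjointable : Type _ := adjointableSubalgebra A E

noncomputable instance : NormedRing (Adjointable A E) :=
  inferInstanceAs (NormedRing (adjointableSubalgebra A E))

noncomputable instance : NormedAlgebra ℂ (Adjointable A E) :=
  inferInstanceAs (NormedAlgebra ℂ (adjointableSubalgebra A E))

instance : CoeFun (Adjointable A E) fun _ => E → E := ⟨fun T => T.1⟩

variable {A E}

/-- The adjoint of an adjointable operator. -/
noncomputable def adjoint (T : Adjointable A E) : Adjointable A E :=
  ⟨T.2.choose, T.1, fun x y => by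
    rw [← CStarModule.star_inner y, ← T.2.choose_spec, CStarModule.star_inner]⟩

theorem inner_adjoint_right (T : Adjointable A E) (x y : E) :
    inner A x ((adjoint T).1 y) = inner A (T.1 x) y :=
  (T.2.choose_spec x y).symm

theorem adjoint_unique {T S : Adjointable A E}
    (h : ∀ x y : E, inner A (T.1 x) y = inner A x (S.1 y)) : adjoint T = S := by
  apply Subtype.ext
  ext y
  exact ext_inner (A := A) fun z => by rw [inner_adjoint_right, h]

noncomputable instance : Star (Adjointable A E) := ⟨adjoint⟩

theorem inner_star_right (T : Adjointable A E) (x y : E) :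
    inner A x ((star T).1 y) = inner A (T.1 x) y := inner_adjoint_right T x y

theorem inner_star_left (T : Adjointable A E) (x y : E) :
    inner A ((star T).1 x) y = inner A x (T.1 y) := by
  rw [← CStarModule.star_inner y, inner_star_right, CStarModule.star_inner]

theorem star_eq_of {T S : Adjointable A E}
    (h : ∀ x y : E, inner A (T.1 x) y = inner A x (S.1 y)) : star T = S := adjoint_unique h

noncomputable instance : StarRing (Adjointable A E) where
  star_involutive T := star_eq_of fun x y => inner_star_left T x y
  star_mul T S := star_eq_of fun x y => by
    change inner A (T.1 (S.1 x)) y = inner A x ((star S).1 ((star T).1 y))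
    rw [inner_star_right, inner_star_right]
  star_add T S := star_eq_of fun x y => by
    change inner A (T.1 x + S.1 x) y = inner A x ((star T).1 y + (star S).1 y)
    rw [CStarModule.inner_add_right, inner_star_right, inner_star_right, CStarModule.inner_add_left]

noncomputable instance : StarModule ℂ (Adjointable A E) where
  star_smul c T := star_eq_of fun x y => by
    change inner A (c • T.1 x) y = inner A x (star c • (star T).1 y)
    rw [CStarModule.inner_smul_right_complex, inner_star_right,
      CStarModule.inner_smul_left_complex]

theorem norm_apply_sq_le (T : Adjointable A E) (x : E) :
    ‖T.1 x‖ ^ 2 ≤ ‖star T * T‖ * ‖x‖ ^ 2 := by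
  rw [CStarModule.norm_sq_eq A, ← inner_star_right]
  calc _ ≤ ‖x‖ * ‖(star T * T).1 x‖ := CStarModule.norm_inner_le (A := A) E
    _ ≤ ‖x‖ * (‖star T * T‖ * ‖x‖) := by
        gcongr
        exact (star T * T).1.le_opNorm x
    _ = _ := by ring

theorem norm_mul_self_le (T : Adjointable A E) : ‖T‖ * ‖T‖ ≤ ‖star T * T‖ := by
  have h : ‖T‖ ≤ √‖star T * T‖ := by
    refine ContinuousLinearMap.opNorm_le_bound T.1 (Real.sqrt_nonneg _) fun x => ?_
    refine abs_le_of_sq_le_sq' ?_ (by positivity) |>.2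
    have h := norm_apply_sq_le T x
    rwa [← Real.sq_sqrt (norm_nonneg (star T * T)), ← mul_pow] at h
  calc _ ≤ √‖star T * T‖ * √‖star T * T‖ := by gcongr
    _ = _ := Real.mul_self_sqrt (norm_nonneg _)

noncomputable instance : CStarRing (Adjointable A E) where
  norm_mul_self_le T := norm_mul_self_le T

theorem norm_le_norm_star (T : Adjointable A E) : ‖T‖ ≤ ‖star T‖ := by
  rcases eq_or_ne T 0 with rfl | h
  · simp
  · have h1 := (norm_mul_self_le T).trans (norm_mul_le _ _)
    exact le_of_mul_le_mul_right h1 (norm_pos_iff.2 h)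

instance [CompleteSpace E] : CompleteSpace (Adjointable A E) := by
  refine Metric.complete_of_cauchySeq_tendsto fun u hu => ?_
  have h1 : CauchySeq fun n => (u n).1 :=
    uniformContinuous_subtype_val.comp_cauchySeq hu
  have h2 : CauchySeq fun n => (star (u n)).1 := by
    have : CauchySeq fun n => star (u n) := by
      rw [Metric.cauchySeq_iff'] at hu ⊢
      intro ε hε
      obtain ⟨N, hN⟩ := hu ε hε
      refine ⟨N, fun n hn => lt_of_le_of_lt ?_ (hN n hn)⟩
      rw [dist_eq_norm, dist_eq_norm, ← star_sub]
      simpa using norm_le_norm_star (star (u n - u N))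
    exact uniformContinuous_subtype_val.comp_cauchySeq this
  obtain ⟨T, hT⟩ := cauchySeq_tendsto_of_complete h1
  obtain ⟨S, hS⟩ := cauchySeq_tendsto_of_complete h2
  have key : ∀ x y, inner A (T x) y = inner A x (S y) := by
    intro x y
    have hc := CStarModule.continuous_inner (A := A) (E := E)
    have a1 : Tendsto (fun n => inner A ((u n).1 x) y) atTop (𝓝 (inner A (T x) y)) :=
      (hc.tendsto (T x, y)).comp
        ((((ContinuousLinearMap.apply ℂ E x).continuous.tendsto T).comp hT).prodMk_nhds
          tendsto_const_nhds)
    have a2 : Tendsto (fun n => inner A x ((star (u n)).1 y)) atTop (𝓝 (inner A x (S y))) :=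
      (hc.tendsto (x, S y)).comp
        (tendsto_const_nhds.prodMk_nhds
          (((ContinuousLinearMap.apply ℂ E y).continuous.tendsto S).comp hS))
    refine tendsto_nhds_unique a1 (a2.congr fun n => ?_)
    rw [inner_star_right]
  exact ⟨⟨T, S, key⟩, tendsto_subtype_rng.2 hT⟩

noncomputable instance [CompleteSpace E] : CStarAlgebra (Adjointable A E) where

theorem smul_eq_of_inner {a : A} {x w : E} (h : ∀ z : E, a * inner A z x = inner A z w) :
    a • x = w :=
  ext_inner (A := A) fun z => by rw [CStarModule.inner_op_smul_right, h]

theorem norm_act_le (a : A) (x : E) : ‖a • x‖ ≤ ‖a‖ * ‖x‖ := by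
  refine abs_le_of_sq_le_sq' ?_ (by positivity) |>.2
  rw [CStarModule.norm_sq_eq A, CStarModule.inner_op_smul_right, CStarModule.inner_op_smul_left,
    mul_pow, CStarModule.norm_sq_eq A (x := x)]
  calc _ ≤ ‖a‖ * (‖inner A x x‖ * ‖star a‖) :=
        (norm_mul_le _ _).trans (by gcongr; exact norm_mul_le _ _)
    _ = _ := by rw [norm_star]; ring

/-- The map `a ↦ a • x`, for `x` in the Hilbert module `E`. -/
noncomputable def actCLM (x : E) : A →L[ℂ] E :=
  LinearMap.mkContinuous
    { toFun := fun a => a • x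
      map_add' := fun a b => smul_eq_of_inner (A := A) fun z => by simp [add_mul]
      map_smul' := fun c a => smul_eq_of_inner (A := A) fun z => by simp [smul_mul_assoc] }
    ‖x‖ fun a => by rw [mul_comm]; exact norm_act_le a x

theorem actCLM_apply (x : E) (a : A) : actCLM x a = a • x := rfl

/-- The rank-one operator `x y^* : z ↦ x ⟨y, z⟩`. -/
noncomputable def rankOne (x y : E) : Adjointable A E :=
  ⟨(actCLM x).comp (CStarModule.innerSL (A := A) y),
    (actCLM y).comp (CStarModule.innerSL (A := A) x), fun z w => by
      simp [actCLM_apply, CStarModule.innerSL_apply]⟩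

variable (A E) in
/-- The compact operators on `E`: the closed linear span of the rank-one operators. -/
noncomputable def compacts : Submodule ℂ (Adjointable A E) :=
  (Submodule.span ℂ {k | ∃ x y : E, k = rankOne x y}).topologicalClosure

/-- Convergence along a filter in the strict topology of `B^a(E)`, seen as the multiplier algebra
of the compact operators. -/
def StrictTendsto {ι : Type*} (f : ι → Adjointable A E) (l : Filter ι) (a : Adjointable A E) :
    Prop :=
  ∀ k ∈ compacts A E,
    Tendsto (fun i => f i * k) l (𝓝 (a * k)) ∧ Tendsto (fun i => k * f i) l (𝓝 (k * a))

/-- A map between algebras of adjointable operators is strict if it sends bounded strictly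
convergent nets to strictly convergent nets (with the limit being sent to the limit). Nets are
replaced by the filters of their tails. -/
def IsStrict {A' E' : Type*} [NonUnitalCStarAlgebra A'] [PartialOrder A'] [StarOrderedRing A']
    [NormedAddCommGroup E'] [NormedSpace ℂ E'] [SMul A' E'] [CStarModule A' E']
    (θ : Adjointable A E → Adjointable A' E') : Prop :=
  ∀ (l : Filter (Adjointable A E)) (a : Adjointable A E), (∃ M : ℝ, ∀ᶠ t in l, ‖t‖ ≤ M) →
    StrictTendsto (fun t => t) l a → StrictTendsto θ l (θ a)

end Adjointable

/-! ### Right Hilbert modules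

Mathlib's `CStarModule A E` carries an action `a • x` with `inner x (a • y) = a * inner x y`.
A right Hilbert module `E` over `B`, with `⟨x, y b⟩ = ⟨x, y⟩ b`, is therefore a
`CStarModule Bᵐᵒᵖ E` (the right action is `op b • x`) that is complete. -/

section Right

variable (B E : Type*) [NonUnitalCStarAlgebra B] [PartialOrder B] [StarOrderedRing B]
  [NormedAddCommGroup E] [NormedSpace ℂ E] [SMul Bᵐᵒᵖ E] [CStarModule Bᵐᵒᵖ E]

variable {E} in
/-- The `B`-valued inner product of a right Hilbert `B`-module, linear in the second variable. -/
def rinner (x y : E) : B := unop (inner Bᵐᵒᵖ x y)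

theorem rinner_act_right (x y : E) (b : B) : rinner B x (op b • y) = rinner B x y * b := by
  simp [rinner]

theorem star_rinner (x y : E) : star (rinner B x y) = rinner B y x := by
  rw [rinner, ← unop_star, CStarModule.star_inner, rinner]

theorem rinner_self_nonneg (x : E) : 0 ≤ rinner B x x :=
  CStarModule.inner_self_nonneg (A := Bᵐᵒᵖ) (x := x)

/-- The `C^*`-algebra `B` as a right Hilbert module over itself, with `⟨c, d⟩ = c^* d`. -/
instance selfModule : CStarModule Bᵐᵒᵖ B where
  inner c d := op (star c * d)
  inner_add_right {x y z} := by rw [mul_add, op_add]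
  inner_self_nonneg {x} := star_mul_self_nonneg x
  inner_self {x} := by rw [op_eq_zero_iff, CStarRing.star_mul_self_eq_zero_iff]
  inner_op_smul_right {a x y} := by
    rw [← op_unop a, op_smul_eq_mul, ← mul_assoc, op_mul]
  inner_smul_right_complex {z x y} := by rw [mul_smul_comm, op_smul]
  star_inner x y := by rw [← op_star, star_mul, star_star]
  norm_eq_sqrt_norm_inner_self x := by
    rw [norm_op, CStarRing.norm_star_mul_self, Real.sqrt_mul_self (norm_nonneg x)]

/-- `E` is full: the inner products span a dense subspace of `B`. -/
def IsFull : Prop :=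
  (Submodule.span ℂ {b : B | ∃ x y : E, b = rinner B x y}).topologicalClosure = ⊤

/-- The right Hilbert `B`-module `B ⊕ E`. -/
abbrev SelfSum : Type _ := WithCStarModule Bᵐᵒᵖ (B × E)

variable {B E}

/-- The map `y ↦ ⟨x, y⟩`. -/
noncomputable def rinnerCLM (x : E) : E →L[ℂ] B :=
  ((opContinuousLinearEquiv ℂ : B ≃L[ℂ] Bᵐᵒᵖ).symm : Bᵐᵒᵖ →L[ℂ] B).comp
    (CStarModule.innerSL (A := Bᵐᵒᵖ) x)

/-- The map `b ↦ x b`. -/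
noncomputable def ractCLM (x : E) : B →L[ℂ] E :=
  (actCLM (A := Bᵐᵒᵖ) x).comp ((opContinuousLinearEquiv ℂ : B ≃L[ℂ] Bᵐᵒᵖ) : B →L[ℂ] Bᵐᵒᵖ)

/-- The operator on `B ⊕ E` with the matrix `[[b, x^*], [x', a]]`. -/
noncomputable def blockCLM (b : B) (x x' : E) (a : E →L[ℂ] E) :
    SelfSum B E →L[ℂ] SelfSum B E :=
  ((WithCStarModule.equivL ℂ (A := Bᵐᵒᵖ) (E := B × E)).symm : B × E →L[ℂ] SelfSum B E).comp
    (((((ContinuousLinearMap.mul ℂ B b).coprod (rinnerCLM x)).prod ((ractCLM x').coprod a))).comp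
      (WithCStarModule.equivL ℂ (A := Bᵐᵒᵖ) (E := B × E) : SelfSum B E →L[ℂ] B × E))

theorem blockCLM_fst (b : B) (x x' : E) (a : E →L[ℂ] E) (v : SelfSum B E) :
    (blockCLM b x x' a v).fst = b * v.fst + rinner B x v.snd := rfl

theorem blockCLM_snd (b : B) (x x' : E) (a : E →L[ℂ] E) (v : SelfSum B E) :
    (blockCLM b x x' a v).snd = op v.fst • x' + a v.snd := rfl

theorem inner_selfSum (v w : SelfSum B E) :
    inner Bᵐᵒᵖ v w = op (star v.fst * w.fst + rinner B v.snd w.snd) := rfl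

theorem inner_blockCLM (b : B) (x x' : E) (a : Adjointable Bᵐᵒᵖ E) (v w : SelfSum B E) :
    inner Bᵐᵒᵖ (blockCLM b x x' a.1 v) w =
      inner Bᵐᵒᵖ v (blockCLM (star b) x' x (star a).1 w) := by
  rw [inner_selfSum, inner_selfSum, blockCLM_fst, blockCLM_snd, blockCLM_fst, blockCLM_snd]
  congr 1
  have h1 : rinner B (op v.fst • x' + a v.snd) w.snd =
      star v.fst * rinner B x' w.snd + rinner B (a v.snd) w.snd := by
    simp [rinner]
  have h2 : rinner B v.snd (op w.fst • x + (star a) w.snd) =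
      rinner B v.snd x * w.fst + rinner B (a v.snd) w.snd := by
    simp [rinner, inner_star_right]
  rw [h1, h2, star_add, star_mul, star_rinner]
  simp only [add_mul, mul_add, mul_assoc]
  abel

/-- The adjointable operator on `B ⊕ E` with the matrix `[[b, x^*], [x', a]]`, that is, the map
`(c, y) ↦ (b c + ⟨x, y⟩, x' c + a y)`. -/
noncomputable def block (b : B) (x x' : E) (a : Adjointable Bᵐᵒᵖ E) :
    Adjointable Bᵐᵒᵖ (SelfSum B E) :=
  ⟨blockCLM b x x' a.1, blockCLM (star b) x' x (star a).1, inner_blockCLM b x x' a⟩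

theorem block_fst (b : B) (x x' : E) (a : Adjointable Bᵐᵒᵖ E) (v : SelfSum B E) :
    (block b x x' a v).fst = b * v.fst + rinner B x v.snd := rfl

theorem block_snd (b : B) (x x' : E) (a : Adjointable Bᵐᵒᵖ E) (v : SelfSum B E) :
    (block b x x' a v).snd = op v.fst • x' + a v.snd := rfl

theorem adjointable_ext {M N : Adjointable Bᵐᵒᵖ (SelfSum B E)}
    (h1 : ∀ v, (M v).fst = (N v).fst) (h2 : ∀ v, (M v).snd = (N v).snd) : M = N := by
  apply Subtype.ext
  ext v
  exact Prod.ext (h1 v) (h2 v)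

theorem star_block (b : B) (x x' : E) (a : Adjointable Bᵐᵒᵖ E) :
    star (block b x x' a) = block (star b) x' x (star a) :=
  star_eq_of (inner_blockCLM b x x' a)

theorem block_add (b c : B) (x x' y y' : E) (a d : Adjointable Bᵐᵒᵖ E) :
    block b x x' a + block c y y' d = block (b + c) (x + y) (x' + y') (a + d) := by
  refine adjointable_ext (fun v => ?_) (fun v => ?_)
  · change (block b x x' a v).fst + (block c y y' d v).fst = _
    simp only [block_fst, rinner, CStarModule.inner_add_left, unop_add, add_mul]
    abel
  · change (block b x x' a v).snd + (block c y y' d v).snd = _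
    have h : op v.fst • (x' + y') = op v.fst • x' + op v.fst • y' :=
      smul_eq_of_inner (A := Bᵐᵒᵖ) fun z => by simp [mul_add]
    have h' : (a + d) v.snd = a v.snd + d v.snd := rfl
    simp only [block_snd, h, h']
    abel

theorem block_smul (z : ℂ) (b : B) (x x' : E) (a : Adjointable Bᵐᵒᵖ E) :
    z • block b x x' a = block (z • b) (star z • x) (z • x') (z • a) := by
  refine adjointable_ext (fun v => ?_) (fun v => ?_)
  · change z • (block b x x' a v).fst = _
    simp [block_fst, rinner, smul_mul_assoc]
  · change z • (block b x x' a v).snd = _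
    have h : op v.fst • (z • x') = z • (op v.fst • x') :=
      smul_eq_of_inner (A := Bᵐᵒᵖ) fun w => by simp [mul_smul_comm]
    have h' : (z • a) v.snd = z • a v.snd := rfl
    simp only [block_snd, h, h', smul_add]

theorem block_zero : block (0 : B) (0 : E) 0 0 = 0 := by
  have h := block_smul 0 (0 : B) (0 : E) 0 0
  simp only [zero_smul, smul_zero] at h
  exact h.symm

theorem block_mul (b c : B) (x x' y y' : E) (a d : Adjointable Bᵐᵒᵖ E) :
    block b x x' a * block c y y' d =
      block (b * c + rinner B x y') (op (star b) • y + star d x) (op c • x' + a y')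
        (rankOne x' y + a * d) := by
  refine adjointable_ext (fun v => ?_) (fun v => ?_)
  · change (block b x x' a (block c y y' d v)).fst = _
    simp only [block_fst, block_snd, rinner, CStarModule.inner_add_left,
      CStarModule.inner_add_right, CStarModule.inner_op_smul_left,
      CStarModule.inner_op_smul_right, inner_star_left, unop_add, unop_mul, unop_op, unop_star,
      star_star, add_mul, mul_add, mul_assoc]
    abel
  · change (block b x x' a (block c y y' d v)).snd = _
    have h1 : op (c * v.fst + rinner B y v.snd) • x' =
        op v.fst • op c • x' + (rankOne x' y) v.snd :=
      smul_eq_of_inner (A := Bᵐᵒᵖ) fun z => by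
        change _ = inner Bᵐᵒᵖ z (op v.fst • op c • x' + inner Bᵐᵒᵖ y v.snd • x')
        simp [rinner, add_mul, mul_assoc]
    have h2 : a (op v.fst • y' + d v.snd) = op v.fst • a y' + (a * d) v.snd :=
      ext_inner (A := Bᵐᵒᵖ) fun z => by
        change _ = inner Bᵐᵒᵖ z (op v.fst • a y' + a (d v.snd))
        simp only [← inner_star_left, CStarModule.inner_add_right,
          CStarModule.inner_op_smul_right]
    have h3 : op v.fst • (op c • x' + a y') = op v.fst • op c • x' + op v.fst • a y' :=
      smul_eq_of_inner (A := Bᵐᵒᵖ) fun z => by simp [mul_add]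
    have h4 : (rankOne x' y + a * d : Adjointable Bᵐᵒᵖ E) v.snd = (rankOne x' y) v.snd + (a * d) v.snd := rfl
    simp only [block_snd, block_fst, h1, h2, h3, h4]
    abel

variable (B E) in
/-- The extended linking algebra `[[B, E^*], [E, B^a(E)]]` of `E`, as a subalgebra of the
algebra of adjointable operators on `B ⊕ E`. -/
def linkingSubalgebra : NonUnitalStarSubalgebra ℂ (Adjointable Bᵐᵒᵖ (SelfSum B E)) where
  carrier := {M | ∃ (b : B) (x x' : E) (a : Adjointable Bᵐᵒᵖ E), M = block b x x' a}
  add_mem' := by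
    rintro _ _ ⟨b, x, x', a, rfl⟩ ⟨c, y, y', d, rfl⟩
    exact ⟨_, _, _, _, block_add ..⟩
  zero_mem' := ⟨0, 0, 0, 0, block_zero.symm⟩
  mul_mem' := by
    rintro _ _ ⟨b, x, x', a, rfl⟩ ⟨c, y, y', d, rfl⟩
    exact ⟨_, _, _, _, block_mul ..⟩
  smul_mem' := by
    rintro z _ ⟨b, x, x', a, rfl⟩
    exact ⟨_, _, _, _, block_smul ..⟩
  star_mem' := by
    rintro _ ⟨b, x, x', a, rfl⟩
    exact ⟨_, _, _, _, star_block ..⟩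

theorem norm_rinner_le (x y : E) : ‖rinner B x y‖ ≤ ‖x‖ * ‖y‖ :=
  CStarModule.norm_inner_le (A := Bᵐᵒᵖ) E

theorem norm_selfSum_le (v : SelfSum B E) : ‖v‖ ≤ ‖v.fst‖ + ‖v.snd‖ :=
  WithCStarModule.prod_norm_le_norm_add v

theorem norm_fst_le (v : SelfSum B E) : ‖v.fst‖ ≤ ‖v‖ :=
  (le_max_left _ _).trans (WithCStarModule.max_le_prod_norm v)

theorem norm_snd_le (v : SelfSum B E) : ‖v.snd‖ ≤ ‖v‖ :=
  (le_max_right _ _).trans (WithCStarModule.max_le_prod_norm v)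

theorem norm_apply_le {A X : Type*} [NonUnitalCStarAlgebra A] [PartialOrder A]
    [StarOrderedRing A] [NormedAddCommGroup X] [NormedSpace ℂ X] [SMul A X] [CStarModule A X]
    (T : Adjointable A X) (x : X) : ‖T x‖ ≤ ‖T‖ * ‖x‖ := T.1.le_opNorm x

theorem norm_block_le (b : B) (x x' : E) (a : Adjointable Bᵐᵒᵖ E) :
    ‖block b x x' a‖ ≤ ‖b‖ + ‖x‖ + ‖x'‖ + ‖a‖ := by
  refine ContinuousLinearMap.opNorm_le_bound (block b x x' a).1 (by positivity) fun v => ?_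
  have h1 := norm_fst_le v
  have h2 := norm_snd_le v
  calc _ ≤ ‖(block b x x' a v).fst‖ + ‖(block b x x' a v).snd‖ := norm_selfSum_le _
    _ ≤ (‖b‖ * ‖v.fst‖ + ‖x‖ * ‖v.snd‖) + (‖v.fst‖ * ‖x'‖ + ‖a‖ * ‖v.snd‖) := by
        rw [block_fst, block_snd]
        refine add_le_add ((norm_add_le _ _).trans ?_) ((norm_add_le _ _).trans ?_)
        · exact add_le_add (norm_mul_le _ _) (norm_rinner_le _ _)
        · refine add_le_add ?_ (norm_apply_le _ _)
          exact (norm_act_le (op v.fst) x').trans_eq (by rw [norm_op])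
    _ ≤ (‖b‖ * ‖v‖ + ‖x‖ * ‖v‖) + (‖v‖ * ‖x'‖ + ‖a‖ * ‖v‖) := by gcongr
    _ = _ := by ring

/-- The element `(c, y)` of `B ⊕ E`. -/
def mkSum (c : B) (y : E) : SelfSum B E := (WithCStarModule.equiv Bᵐᵒᵖ (B × E)).symm (c, y)

theorem norm_left_le (b : B) (x x' : E) (a : Adjointable Bᵐᵒᵖ E) : ‖b‖ ≤ ‖block b x x' a‖ := by
  rcases eq_or_ne b 0 with rfl | hb
  · simp
  refine le_of_mul_le_mul_right ?_ (norm_pos_iff.2 hb)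
  have h0 : ‖mkSum (star b) (0 : E)‖ ≤ ‖b‖ := by
    simpa [mkSum] using norm_selfSum_le (mkSum (star b) (0 : E))
  have h1 : (block b x x' a (mkSum (star b) 0)).fst = b * star b := by
    simp [block_fst, mkSum, rinner]
  calc ‖b‖ * ‖b‖ = ‖b * star b‖ := (CStarRing.norm_self_mul_star).symm
    _ ≤ ‖block b x x' a (mkSum (star b) 0)‖ := h1 ▸ norm_fst_le _
    _ ≤ ‖block b x x' a‖ * ‖b‖ := (norm_apply_le _ _).trans (by gcongr)

theorem norm_upper_le (b : B) (x x' : E) (a : Adjointable Bᵐᵒᵖ E) : ‖x‖ ≤ ‖block b x x' a‖ := by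
  rcases eq_or_ne x 0 with rfl | hx
  · simp
  refine le_of_mul_le_mul_right ?_ (norm_pos_iff.2 hx)
  have h0 : ‖mkSum (0 : B) x‖ ≤ ‖x‖ := by
    simpa [mkSum] using norm_selfSum_le (mkSum (0 : B) x)
  have h1 : (block b x x' a (mkSum 0 x)).fst = rinner B x x := by
    simp [block_fst, mkSum]
  calc ‖x‖ * ‖x‖ = ‖rinner B x x‖ := by
        rw [← pow_two, CStarModule.norm_sq_eq Bᵐᵒᵖ, rinner, norm_unop]
    _ ≤ ‖block b x x' a (mkSum 0 x)‖ := h1 ▸ norm_fst_le _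
    _ ≤ ‖block b x x' a‖ * ‖x‖ := (norm_apply_le _ _).trans (by gcongr)

theorem norm_corner_le (b : B) (x x' : E) (a : Adjointable Bᵐᵒᵖ E) :
    ‖a‖ ≤ ‖block b x x' a‖ := by
  refine ContinuousLinearMap.opNorm_le_bound a.1 (norm_nonneg _) fun y => ?_
  have h0 : ‖mkSum (0 : B) y‖ ≤ ‖y‖ := by
    simpa [mkSum] using norm_selfSum_le (mkSum (0 : B) y)
  have h2 : (0 : Bᵐᵒᵖ) • x' = 0 := smul_eq_of_inner (A := Bᵐᵒᵖ) fun z => by simp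
  have h1 : (block b x x' a (mkSum 0 y)).snd = a y := by
    simp [block_snd, mkSum, h2]
  calc ‖a y‖ ≤ ‖block b x x' a (mkSum 0 y)‖ := h1 ▸ norm_snd_le _
    _ ≤ ‖block b x x' a‖ * ‖y‖ := (norm_apply_le _ _).trans (by gcongr)

/-- The four corners put together, as an additive map. -/
noncomputable def blockHom :
    B × E × E × Adjointable Bᵐᵒᵖ E →+ Adjointable Bᵐᵒᵖ (SelfSum B E) where
  toFun p := block p.1 p.2.1 p.2.2.1 p.2.2.2
  map_zero' := block_zero
  map_add' _ _ := (block_add ..).symm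

instance [CompleteSpace E] :
    IsClosed (linkingSubalgebra B E : Set (Adjointable Bᵐᵒᵖ (SelfSum B E))) := by
  have h1 : AntilipschitzWith 1 (blockHom (B := B) (E := E)) := by
    refine AddMonoidHomClass.antilipschitz_of_bound _ fun p => ?_
    have h := norm_upper_le (star p.1) p.2.2.1 p.2.1 (star p.2.2.2)
    rw [← star_block, norm_star] at h
    rw [NNReal.coe_one, one_mul]
    exact max_le (norm_left_le ..) (max_le (norm_upper_le ..) (max_le h (norm_corner_le ..)))
  have h2 : LipschitzWith 4 (blockHom (B := B) (E := E)) := by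
    refine AddMonoidHomClass.lipschitz_of_bound_nnnorm _ 4 fun p => ?_
    have e1 : ‖p.1‖ ≤ ‖p‖ := _root_.norm_fst_le p
    have e2 : ‖p.2‖ ≤ ‖p‖ := _root_.norm_snd_le p
    have e3 : ‖p.2.1‖ ≤ ‖p‖ := (_root_.norm_fst_le p.2).trans e2
    have e4 : ‖p.2.2‖ ≤ ‖p‖ := (_root_.norm_snd_le p.2).trans e2
    have e5 : ‖p.2.2.1‖ ≤ ‖p‖ := (_root_.norm_fst_le p.2.2).trans e4
    have e6 : ‖p.2.2.2‖ ≤ ‖p‖ := (_root_.norm_snd_le p.2.2).trans e4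
    have h := norm_block_le p.1 p.2.1 p.2.2.1 p.2.2.2
    have : ‖blockHom p‖ ≤ 4 * ‖p‖ := h.trans (by linarith)
    exact_mod_cast this
  have h3 := h1.isClosed_range h2.uniformContinuous
  convert h3 using 1
  ext M
  constructor
  · rintro ⟨b, x, x', a, rfl⟩
    exact ⟨(b, x, x', a), rfl⟩
  · rintro ⟨p, rfl⟩
    exact ⟨_, _, _, _, rfl⟩

variable (B E) in
/-- The extended linking algebra of `E` as a type. -/
def LinkingAlgebra : Type _ := linkingSubalgebra B E

noncomputable instance [CompleteSpace E] : NonUnitalCStarAlgebra (LinkingAlgebra B E) :=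
  NonUnitalStarSubalgebra.nonUnitalCStarAlgebra (linkingSubalgebra B E)

noncomputable instance [CompleteSpace E] : PartialOrder (LinkingAlgebra B E) :=
  CStarAlgebra.spectralOrder _

instance [CompleteSpace E] : StarOrderedRing (LinkingAlgebra B E) :=
  CStarAlgebra.spectralOrderedRing _

/-- The element `[[b, x^*], [x', a]]` of the extended linking algebra. -/
noncomputable def linkMatrix (b : B) (x x' : E) (a : Adjointable Bᵐᵒᵖ E) : LinkingAlgebra B E :=
  ⟨block b x x' a, b, x, x', a, rfl⟩

end Right

/-! ### CPH-dilations and CPH-maps -/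

section CPH

variable {B C E F : Type*}
  [NonUnitalCStarAlgebra B] [PartialOrder B] [StarOrderedRing B]
  [NonUnitalCStarAlgebra C] [PartialOrder C] [StarOrderedRing C]
  [NormedAddCommGroup E] [NormedSpace ℂ E] [SMul Bᵐᵒᵖ E] [CStarModule Bᵐᵒᵖ E] [CompleteSpace E]
  [NormedAddCommGroup F] [NormedSpace ℂ F] [SMul Cᵐᵒᵖ F] [CStarModule Cᵐᵒᵖ F] [CompleteSpace F]

/-- The dilation diagram commutes: `τ ⟨x, a x'⟩ = ⟨T x, θ(a) T x'⟩`. -/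
def DiagramCommutes (τ : B →CP C) (θ : Adjointable Bᵐᵒᵖ E →⋆ₙₐ[ℂ] Adjointable Cᵐᵒᵖ F)
    (T : E → F) : Prop :=
  ∀ (a : Adjointable Bᵐᵒᵖ E) (x x' : E), τ (rinner B x (a x')) = rinner C (T x) (θ a (T x'))

/-- `θ` is a strict CPH₀-dilation of `τ`. -/
structure IsStrictCPH0Dilation (τ : B →CP C)
    (θ : Adjointable Bᵐᵒᵖ E →⋆ₙₐ[ℂ] Adjointable Cᵐᵒᵖ F) : Prop where
  full : IsFull B E
  exists_map : ∃ T : E → F, DiagramCommutes τ θ T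
  strict : IsStrict θ
  unital : θ 1 = 1

/-- The block-wise map `[[τ, T^*], [T, θ]]` between the extended linking algebras is a
(linear and) completely positive map, where `T^* (x^*) = (T x)^*`. -/
def BlockwiseCP (τ : B → C) (T : E → F) (θ : Adjointable Bᵐᵒᵖ E → Adjointable Cᵐᵒᵖ F) : Prop :=
  ∃ S : LinkingAlgebra B E →CP LinkingAlgebra C F,
    ∀ (b : B) (x x' : E) (a : Adjointable Bᵐᵒᵖ E),
      S (linkMatrix b x x' a) = linkMatrix (τ b) (T x) (T x') (θ a)

variable (B C) in
/-- `T` is a strict CPH₀-map: it extends to a block-wise completely positive map between the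
extended linking algebras whose 22-corner is a strict unital homomorphism. -/
def IsStrictCPH0Map (T : E → F) : Prop :=
  ∃ (τ : B →CP C) (θ : Adjointable Bᵐᵒᵖ E →⋆ₙₐ[ℂ] Adjointable Cᵐᵒᵖ F),
    IsStrict θ ∧ θ 1 = 1 ∧ BlockwiseCP τ T θ

end CPH

end HilbertMod

namespace HilbertMod

open MulOpposite
open scoped CStarAlgebra
set_option linter.unusedSectionVars false

/-! ### Fullness over a unital algebra: a finite family `z` with `∑ ⟨z k, z k⟩ = 1`. -/

section Full

variable {B E : Type*} [CStarAlgebra B] [PartialOrder B] [StarOrderedRing B]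
  [NormedAddCommGroup E] [NormedSpace ℂ E] [SMul Bᵐᵒᵖ E] [CStarModule Bᵐᵒᵖ E]

/-! Write a matrix in the linking algebra of `E` as an upper row `(b, x^*)` over a lower row `(x',
a)`. A product `A^* D` is the sum of the products of the upper rows and of the lower rows. On lower
rows the block-wise map `S` respects the product: the entries of `(x', a)^* (y', d)` are `⟨x', y'⟩`,
`x'^* d`, `a^* y'`, `a^* d`, and the diagram gives `⟨T x', T y'⟩ = τ ⟨x', y'⟩` and `T (a x) = θ(a) T
x` (`DiagramCommutes.rinner_map`, `DiagramCommutes.map_apply`).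

Upper rows are turned into lower rows by fullness. Since `B` is unital, there are finitely many `z
k` in `E` with `∑ ⟨z k, z k⟩ = 1` (`IsFull.exists_sum_rinner_eq_one`). Inserting this sum between
two upper rows replaces `(b, x^*)` by the lower rows `z k (b, x^*) = (z k b, z k x^*)`
(`star_linkMatrix_mul_eq_sum`).

Hence `S (A^* D)` is a finite sum of terms `φ k (A)^* φ k (D)`. As positive matrices have the form
`N^* N`, this makes `S` completely positive (`map_cstarMatrix_nonneg_of_sum`). Linearity of `T`,
which is not assumed, also follows from the diagram. -/

theorem rinner_act_left (x y : E) (b : B) : rinner B (op b • x) y = star b * rinner B x y := by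
  simp [rinner]

/-- Expand `0 ≤ ⟨x - y, x - y⟩`. -/
theorem rinner_add_star_le (x y : E) :
    rinner B x y + star (rinner B x y) ≤ rinner B x x + rinner B y y := by
  have h := rinner_self_nonneg (B := B) (E := E) (x - y)
  have e : rinner B (x - y) (x - y) =
      (rinner B x x + rinner B y y) - (rinner B x y + star (rinner B x y)) := by
    rw [star_rinner]
    simp only [rinner, CStarModule.inner_sub_left, CStarModule.inner_sub_right, unop_sub]
    abel
  rwa [e, sub_nonneg] at h

/-- The real part of an element of the span of the inner products is dominated by a finite sum of
squares. -/
theorem exists_add_star_le_sum {u : B}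
    (hu : u ∈ Submodule.span ℂ {b : B | ∃ x y : E, b = rinner B x y}) :
    ∃ (n : ℕ) (z : Fin n → E), u + star u ≤ ∑ k, rinner B (z k) (z k) := by
  induction hu using Submodule.closure_induction with
  | zero => exact ⟨0, Fin.elim0, by simp⟩
  | add u v _ _ hu hv =>
    obtain ⟨n, z, hz⟩ := hu
    obtain ⟨m, w, hw⟩ := hv
    refine ⟨n + m, Fin.append z w, ?_⟩
    rw [Fin.sum_univ_add]
    simp only [Fin.append_left, Fin.append_right]
    calc u + v + star (u + v) = (u + star u) + (v + star v) := by rw [star_add]; abel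
      _ ≤ _ := add_le_add hz hw
  | smul_mem c u hu =>
    obtain ⟨x, y, rfl⟩ := hu
    -- The induction meets scalars only on generators, where `c` is absorbed into the second vector;
    -- the bound itself would not survive a complex multiple.
    refine ⟨2, ![x, c • y], ?_⟩
    have e : c • rinner B x y = rinner B x (c • y) := by simp [rinner]
    rw [e, Fin.sum_univ_two]
    exact rinner_add_star_le x (c • y)

/-- Over a unital algebra, a full Hilbert module has a finite power that contains a unit vector. -/
theorem IsFull.exists_sum_rinner_eq_one (h : IsFull B E) :
    ∃ (n : ℕ) (z : Fin n → E), ∑ k, rinner B (z k) (z k) = 1 := by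
  have h1 : (1 : B) ∈ closure
      (Submodule.span ℂ {b : B | ∃ x y : E, b = rinner B x y} : Set B) := by
    rw [← Submodule.topologicalClosure_coe, h]
    trivial
  -- Distance `1 / 2` gives `(1 - u) + (1 - u)^*` norm at most `1`, hence `1 ≤ u + u^* ≤ g`.
  obtain ⟨u, hu, hdist⟩ := Metric.mem_closure_iff.1 h1 (1 / 2) (by norm_num)
  obtain ⟨n, z, hz⟩ := exists_add_star_le_sum hu
  set g := ∑ k, rinner B (z k) (z k) with hg
  have hsa : IsSelfAdjoint ((1 - u) + star (1 - u)) := IsSelfAdjoint.add_star_self _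
  have hn : ‖(1 - u) + star (1 - u)‖ ≤ 1 := by
    rw [dist_eq_norm] at hdist
    calc _ ≤ ‖1 - u‖ + ‖star (1 - u)‖ := norm_add_le _ _
      _ ≤ 1 := by rw [norm_star]; linarith
  have hle : (1 - u) + star (1 - u) ≤ 1 :=
    hsa.le_algebraMap_norm_self.trans
      (by simpa using algebraMap_mono B hn)
  have h1g : 1 ≤ g := by
    refine le_trans ?_ hz
    rw [star_sub, star_one] at hle
    have := sub_nonneg.2 hle
    rw [← sub_nonneg]
    convert this using 1
    abel
  have hgu : IsUnit g := CStarAlgebra.isUnit_of_le 1 h1g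
  have hg0 : 0 ≤ g := zero_le_one.trans h1g
  have hsu : IsUnit (CFC.sqrt g) := by
    rwa [CFC.isUnit_sqrt_iff g hg0]
  obtain ⟨s, hs⟩ := hsu
  have hss : (s : B) * s = g := by rw [hs]; exact CFC.sqrt_mul_sqrt_self g hg0
  have hsstar : star (s : B) = s := by
    rw [hs]; exact (CFC.sqrt_nonneg g).isSelfAdjoint
  have hinv : star (↑s⁻¹ : B) = ↑s⁻¹ := by
    have : star s = s := Units.ext hsstar
    rw [← Units.coe_star_inv, this]
  -- With `s = √g` self-adjoint and invertible, the vectors `z k s⁻¹` have `∑ ⟨z k s⁻¹, z k s⁻¹⟩ =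
  -- s⁻¹ g s⁻¹ = 1`.
  refine ⟨n, fun k => op (↑s⁻¹ : B) • z k, ?_⟩
  simp only [rinner_act_right, rinner_act_left, hinv]
  rw [← Finset.sum_mul, ← Finset.mul_sum, ← hg, ← hss]
  simp

end Full

/-! ### Coordinates and arithmetic in the extended linking algebra. -/

section Linking

variable {B E : Type*} [NonUnitalCStarAlgebra B] [PartialOrder B] [StarOrderedRing B]
  [NormedAddCommGroup E] [NormedSpace ℂ E] [SMul Bᵐᵒᵖ E] [CStarModule Bᵐᵒᵖ E] [CompleteSpace E]

/-- The norm of a block matrix dominates each corner, so a vanishing difference has vanishing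
corners; the lower left corner is reached through the adjoint. -/
theorem block_inj {b c : B} {x x' y y' : E} {a d : Adjointable Bᵐᵒᵖ E}
    (h : block b x x' a = block c y y' d) : b = c ∧ x = y ∧ x' = y' ∧ a = d := by
  have h0 : block (b - c) (x - y) (x' - y') (a - d) = 0 := by
    have := block_add (b - c) c (x - y) (x' - y') y y' (a - d) d
    simp only [sub_add_cancel] at this
    rw [h] at this
    exact add_eq_right.1 this
  have h0' : block (star (b - c)) (x' - y') (x - y) (star (a - d)) = 0 := by
    rw [← star_block, h0, star_zero]
  have h1 := norm_left_le (b - c) (x - y) (x' - y') (a - d)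
  have h2 := norm_upper_le (b - c) (x - y) (x' - y') (a - d)
  have h3 := norm_upper_le (star (b - c)) (x' - y') (x - y) (star (a - d))
  have h4 := norm_corner_le (b - c) (x - y) (x' - y') (a - d)
  rw [h0, norm_zero, norm_le_zero_iff, sub_eq_zero] at h1 h2 h4
  rw [h0', norm_zero, norm_le_zero_iff, sub_eq_zero] at h3
  exact ⟨h1, h2, h3, h4⟩

theorem exists_eq_linkMatrix (A : LinkingAlgebra B E) :
    ∃ (b : B) (x x' : E) (a : Adjointable Bᵐᵒᵖ E), A = linkMatrix b x x' a := by
  obtain ⟨_, b, x, x', a, rfl⟩ := A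
  exact ⟨b, x, x', a, rfl⟩

theorem linkMatrix_add (b c : B) (x x' y y' : E) (a d : Adjointable Bᵐᵒᵖ E) :
    linkMatrix b x x' a + linkMatrix c y y' d =
      linkMatrix (b + c) (x + y) (x' + y') (a + d) :=
  Subtype.ext (block_add ..)

theorem linkMatrix_smul (z : ℂ) (b : B) (x x' : E) (a : Adjointable Bᵐᵒᵖ E) :
    z • linkMatrix b x x' a = linkMatrix (z • b) (star z • x) (z • x') (z • a) :=
  Subtype.ext (block_smul ..)

theorem linkMatrix_mul (b c : B) (x x' y y' : E) (a d : Adjointable Bᵐᵒᵖ E) :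
    linkMatrix b x x' a * linkMatrix c y y' d =
      linkMatrix (b * c + rinner B x y') (op (star b) • y + star d x) (op c • x' + a y')
        (rankOne x' y + a * d) :=
  Subtype.ext (block_mul ..)

theorem star_linkMatrix (b : B) (x x' : E) (a : Adjointable Bᵐᵒᵖ E) :
    star (linkMatrix b x x' a) = linkMatrix (star b) x' x (star a) :=
  Subtype.ext (star_block ..)

/-- The product of the adjoint of a lower row with a lower row. -/
theorem star_linkMatrix_mul_lower (x' y' : E) (a d : Adjointable Bᵐᵒᵖ E) :
    star (linkMatrix (0 : B) 0 x' a) * linkMatrix (0 : B) 0 y' d =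
      linkMatrix (rinner B x' y') (star d x') (star a y') (star a * d) := by
  rw [star_linkMatrix, linkMatrix_mul]
  have h (w : E) : op (0 : B) • w = 0 := smul_eq_of_inner (A := Bᵐᵒᵖ) fun z => by simp
  have h' : (rankOne 0 0 : Adjointable Bᵐᵒᵖ E) = 0 :=
    Subtype.ext (ContinuousLinearMap.ext fun z =>
      smul_eq_of_inner (A := Bᵐᵒᵖ) fun w => by
        change _ = inner Bᵐᵒᵖ w 0
        simp)
  rw [star_star, h, h', mul_zero, zero_add, zero_add, zero_add, zero_add]

end Linking

/-! ### Consequences of the diagram for `T`, and a criterion for complete positivity. -/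

section CPH

variable {B C E F : Type*}
  [NonUnitalCStarAlgebra B] [PartialOrder B] [StarOrderedRing B]
  [NonUnitalCStarAlgebra C] [PartialOrder C] [StarOrderedRing C]
  [NormedAddCommGroup E] [NormedSpace ℂ E] [SMul Bᵐᵒᵖ E] [CStarModule Bᵐᵒᵖ E] [CompleteSpace E]
  [NormedAddCommGroup F] [NormedSpace ℂ F] [SMul Cᵐᵒᵖ F] [CStarModule Cᵐᵒᵖ F] [CompleteSpace F]
  {τ : B →CP C} {θ : Adjointable Bᵐᵒᵖ E →⋆ₙₐ[ℂ] Adjointable Cᵐᵒᵖ F} {T : E → F}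

theorem DiagramCommutes.rinner_map (hT : DiagramCommutes τ θ T) (h1 : θ 1 = 1) (x y : E) :
    rinner C (T x) (T y) = τ (rinner B x y) := by
  have h := hT 1 x y
  rw [h1] at h
  exact h.symm

/-- The hypotheses make `⟨x - y, x - y⟩` vanish. Testing only against `x` and `y` matters because
the range of `T` need not generate `F`, while inner products of vectors in that range are values of
`τ`. -/
theorem eq_of_rinner_self {x y : F} (h : rinner C x x = rinner C x y)
    (h' : rinner C y x = rinner C y y) : x = y := by
  have : rinner C (x - y) (x - y) = 0 := by
    simp only [rinner, CStarModule.inner_sub_left, CStarModule.inner_sub_right, unop_sub] at *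
    rw [h, h']
    abel
  exact sub_eq_zero.1 ((CStarModule.inner_self (A := Cᵐᵒᵖ)).1 (unop_injective this))

/-- All inner products among `T (x + y)`, `T x` and `T y` are values of the additive map `τ`, so
they agree as required by `eq_of_rinner_self`. -/
theorem DiagramCommutes.map_add (hT : DiagramCommutes τ θ T) (h1 : θ 1 = 1) (x y : E) :
    T (x + y) = T x + T y := by
  have e (u v w : F) : rinner C u (v + w) = rinner C u v + rinner C u w := by simp [rinner]
  have e' (u v w : F) : rinner C (u + v) w = rinner C u w + rinner C v w := by simp [rinner]
  have d (u v w : E) : rinner B u (v + w) = rinner B u v + rinner B u w := by simp [rinner]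
  have d' (u v w : E) : rinner B (u + v) w = rinner B u w + rinner B v w := by simp [rinner]
  apply eq_of_rinner_self (C := C) <;>
    simp only [e, e', d, d', hT.rinner_map h1, _root_.map_add]; abel

theorem DiagramCommutes.map_smul (hT : DiagramCommutes τ θ T) (h1 : θ 1 = 1) (z : ℂ) (x : E) :
    T (z • x) = z • T x := by
  have e (u v : F) : rinner C u (z • v) = z • rinner C u v := by simp [rinner]
  have e' (u v : F) : rinner C (z • u) v = star z • rinner C u v := by simp [rinner]
  have d (u v : E) : rinner B u (z • v) = z • rinner B u v := by simp [rinner]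
  have d' (u v : E) : rinner B (z • u) v = star z • rinner B u v := by simp [rinner]
  apply eq_of_rinner_self (C := C) <;>
    simp only [e, e', d, d', hT.rinner_map h1, _root_.map_smul, smul_comm (star z)]

/-- The inner products among `T (a x)` and `θ(a) T x` all equal `τ ⟨a x, a x⟩`, after moving `θ(a)`
across as `θ(a^*)` where needed. -/
theorem DiagramCommutes.map_apply (hT : DiagramCommutes τ θ T) (h1 : θ 1 = 1)
    (a : Adjointable Bᵐᵒᵖ E) (x : E) : T (a x) = θ a (T x) := by
  have e (u v : F) : rinner C (θ a u) v = rinner C u (θ (star a) v) := by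
    rw [map_star, rinner, rinner, inner_star_right]
  apply eq_of_rinner_self (C := C)
  · rw [hT.rinner_map h1, hT]
  · have h : θ (star a) (θ a (T x)) = θ (star a * a) (T x) := by
      rw [_root_.map_mul]; rfl
    rw [e, e, h, ← hT, ← hT]
    rfl

theorem exists_eq_star_mul_self {A : Type*} [NonUnitalCStarAlgebra A] [PartialOrder A]
    [StarOrderedRing A] {a : A} (ha : 0 ≤ a) : ∃ b, a = star b * b :=
  CStarAlgebra.nonneg_iff_eq_star_mul_self.1 ha

/-- A linear map `S` is completely positive if `S (x^* y)` is a finite sum of terms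
`φ(x)^* φ(y)`. -/
theorem map_cstarMatrix_nonneg_of_sum {A D : Type*} [NonUnitalCStarAlgebra A] [PartialOrder A]
    [StarOrderedRing A] [NonUnitalCStarAlgebra D] [PartialOrder D] [StarOrderedRing D]
    {ι : Type*} [Fintype ι] (S : A →ₗ[ℂ] D) (φ : ι → A → D)
    (h : ∀ x y, S (star x * y) = ∑ k, star (φ k x) * φ k y)
    (n : ℕ) (M : CStarMatrix (Fin n) (Fin n) A) (hM : 0 ≤ M) : 0 ≤ M.map S := by
  obtain ⟨N, rfl⟩ := exists_eq_star_mul_self hM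
  -- Each entry of `N^* N` is a sum of terms `(N l i)^* N l j`; only `S` has to be additive here,
  -- the `φ k` may be arbitrary functions.
  have e : (star N * N).map S = ∑ k, star (N.map (φ k)) * N.map (φ k) := by
    ext i j
    have hs (P : ι → CStarMatrix (Fin n) (Fin n) D) : (∑ k, P k) i j = ∑ k, P k i j :=
      Matrix.sum_apply i j Finset.univ P
    rw [hs]
    simp only [CStarMatrix.map_apply, CStarMatrix.mul_apply, CStarMatrix.star_apply, map_sum, h]
    exact Finset.sum_comm
  rw [e]
  exact Finset.sum_nonneg fun k _ => star_mul_self_nonneg _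

/-- The block-wise linear map `[[τ, T^*], [T, θ]]`. -/
theorem DiagramCommutes.exists_linearMap (hT : DiagramCommutes τ θ T) (h1 : θ 1 = 1) :
    ∃ S : LinkingAlgebra B E →ₗ[ℂ] LinkingAlgebra C F,
      ∀ (b : B) (x x' : E) (a : Adjointable Bᵐᵒᵖ E),
        S (linkMatrix b x x' a) = linkMatrix (τ b) (T x) (T x') (θ a) := by
  choose b x x' a h using exists_eq_linkMatrix (B := B) (E := E)
  let f : LinkingAlgebra B E → LinkingAlgebra C F := fun A =>
    linkMatrix (τ (b A)) (T (x A)) (T (x' A)) (θ (a A))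
  -- Corners are unique, so the chosen coordinates agree with any given ones.
  have hf (c : B) (y y' : E) (d : Adjointable Bᵐᵒᵖ E) :
      f (linkMatrix c y y' d) = linkMatrix (τ c) (T y) (T y') (θ d) := by
    obtain ⟨h1, h2, h3, h4⟩ := block_inj (congrArg Subtype.val (h (linkMatrix c y y' d)))
    simp only [f, ← h1, ← h2, ← h3, ← h4]
  refine ⟨⟨⟨f, fun A D => ?_⟩, fun z A => ?_⟩, hf⟩
  · obtain ⟨b, x, x', a, rfl⟩ := exists_eq_linkMatrix A
    obtain ⟨c, y, y', d, rfl⟩ := exists_eq_linkMatrix D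
    rw [linkMatrix_add, hf, hf, hf, linkMatrix_add, hT.map_add h1, hT.map_add h1,
      _root_.map_add, _root_.map_add]
  · obtain ⟨b, x, x', a, rfl⟩ := exists_eq_linkMatrix A
    change f (z • linkMatrix b x x' a) = z • f (linkMatrix b x x' a)
    -- The upper corner `x^*` is conjugate linear in `x`, so homogeneity of `T` is used for both
    -- `star z` and `z`.
    rw [linkMatrix_smul, hf, hf, linkMatrix_smul, hT.map_smul h1, hT.map_smul h1,
      _root_.map_smul, _root_.map_smul]

end CPH

/-! ### Factorization through lower rows and complete positivity of the block-wise map. -/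

section Main

variable {B C E F : Type*}
  [CStarAlgebra B] [PartialOrder B] [StarOrderedRing B]
  [NonUnitalCStarAlgebra C] [PartialOrder C] [StarOrderedRing C]
  [NormedAddCommGroup E] [NormedSpace ℂ E] [SMul Bᵐᵒᵖ E] [CStarModule Bᵐᵒᵖ E] [CompleteSpace E]
  [NormedAddCommGroup F] [NormedSpace ℂ F] [SMul Cᵐᵒᵖ F] [CStarModule Cᵐᵒᵖ F] [CompleteSpace F]
  {τ : B →CP C} {θ : Adjointable Bᵐᵒᵖ E →⋆ₙₐ[ℂ] Adjointable Cᵐᵒᵖ F} {T : E → F}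

theorem linkMatrix_zero : linkMatrix (0 : B) (0 : E) 0 0 = 0 := Subtype.ext block_zero

theorem linkMatrix_sum {ι : Type*} (s : Finset ι) (b : ι → B) (x x' : ι → E)
    (a : ι → Adjointable Bᵐᵒᵖ E) :
    ∑ k ∈ s, linkMatrix (b k) (x k) (x' k) (a k) =
      linkMatrix (∑ k ∈ s, b k) (∑ k ∈ s, x k) (∑ k ∈ s, x' k) (∑ k ∈ s, a k) := by
  classical
  induction s using Finset.induction_on with
  | empty => simp [linkMatrix_zero]
  | insert i s hi ih => simp only [Finset.sum_insert hi, ih, linkMatrix_add]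

theorem star_rankOne (x y : E) : star (rankOne x y : Adjointable Bᵐᵒᵖ E) = rankOne y x :=
  star_eq_of fun z w => by
    change inner Bᵐᵒᵖ (inner Bᵐᵒᵖ y z • x) w = inner Bᵐᵒᵖ z (inner Bᵐᵒᵖ x w • y)
    simp

theorem rankOne_apply (x y z : E) :
    (rankOne x y : Adjointable Bᵐᵒᵖ E) z = op (rinner B y z) • x := rfl

theorem sum_adjointable_apply {ι : Type*} (s : Finset ι) (a : ι → Adjointable Bᵐᵒᵖ E) (v : E) :
    (∑ k ∈ s, a k) v = ∑ k ∈ s, a k v := by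
  classical
  induction s using Finset.induction_on with
  | empty => rfl
  | insert i s hi ih =>
    rw [Finset.sum_insert hi, Finset.sum_insert hi, ← ih]
    rfl

/-- If `∑ ⟨z k, z k⟩ = 1`, the elements of the linking algebra factor through lower rows. -/
theorem star_linkMatrix_mul_eq_sum {n : ℕ} {z : Fin n → E}
    (hz : ∑ k, rinner B (z k) (z k) = 1) (b c : B) (x x' y y' : E)
    (a d : Adjointable Bᵐᵒᵖ E) :
    star (linkMatrix b x x' a) * linkMatrix c y y' d =
      star (linkMatrix (0 : B) 0 x' a) * linkMatrix (0 : B) 0 y' d +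
      ∑ k, star (linkMatrix (0 : B) 0 (op b • z k) (rankOne (z k) x)) *
        linkMatrix (0 : B) 0 (op c • z k) (rankOne (z k) y) := by
  have hsum (u v : B) : ∑ k, u * rinner B (z k) (z k) * v = u * v := by
    rw [← Finset.sum_mul, ← Finset.mul_sum, hz, mul_one]
  simp only [star_linkMatrix_mul_lower, linkMatrix_sum, linkMatrix_add]
  rw [star_linkMatrix, linkMatrix_mul]
  -- This is `∑ u ⟨z k, z k⟩ r = u r`; it yields both off-diagonal corners and, with `r = ⟨y, v⟩`,
  -- the rank-one term `x y^*` applied to `v`.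
  have hA (u : E) (r : B) : ∑ k, (rankOne u (z k) : Adjointable Bᵐᵒᵖ E) (op r • z k) =
      op r • u := by
    refine ext_inner (A := Bᵐᵒᵖ) fun w => unop_injective ?_
    rw [CStarModule.inner_sum_right, Finset.unop_sum]
    change ∑ k, rinner B w ((rankOne u (z k) : Adjointable Bᵐᵒᵖ E) (op r • z k)) =
      rinner B w (op r • u)
    simp only [rankOne_apply, rinner_act_right, ← hsum (rinner B w u) r, mul_assoc]
  simp only [star_rankOne, star_star, hA]
  congr 1
  · simp only [rinner_act_left, rinner_act_right, ← hsum (star b) c, mul_assoc]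
    abel
  · abel
  · abel
  · have hB : ∑ k, (rankOne x (z k) * rankOne (z k) y : Adjointable Bᵐᵒᵖ E) = rankOne x y := by
      refine Subtype.ext (ContinuousLinearMap.ext fun v => ?_)
      rw [sum_adjointable_apply]
      exact hA x (rinner B y v)
    rw [hB, add_comm]


theorem DiagramCommutes.blockwiseCP (hT : DiagramCommutes τ θ T) (h1 : θ 1 = 1)
    (hE : IsFull B E) : BlockwiseCP τ T θ := by
  obtain ⟨S, hS⟩ := hT.exists_linearMap h1
  obtain ⟨n, z, hz⟩ := hE.exists_sum_rinner_eq_one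
  choose b x x' a h using exists_eq_linkMatrix (B := B) (E := E)
  -- `S` is multiplicative on products of lower rows.
  have key (x' y' : E) (a d : Adjointable Bᵐᵒᵖ E) :
      S (star (linkMatrix (0 : B) 0 x' a) * linkMatrix (0 : B) 0 y' d) =
        star (linkMatrix (0 : C) 0 (T x') (θ a)) * linkMatrix (0 : C) 0 (T y') (θ d) := by
    rw [star_linkMatrix_mul_lower, star_linkMatrix_mul_lower, hS, hT.map_apply h1,
      hT.map_apply h1, hT.rinner_map h1, map_star, map_star, _root_.map_mul, map_star]
  -- The index `none` carries the lower row of `A`; `some k` carries `z k` times its upper row.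
  let φ : Option (Fin n) → LinkingAlgebra B E → LinkingAlgebra C F
    | none, A => linkMatrix 0 0 (T (x' A)) (θ (a A))
    | some k, A => linkMatrix 0 0 (T (op (b A) • z k)) (θ (rankOne (z k) (x A)))
  refine ⟨⟨S, map_cstarMatrix_nonneg_of_sum S φ fun A D => ?_⟩, hS⟩
  conv_lhs => rw [h A, h D, star_linkMatrix_mul_eq_sum hz, _root_.map_add, map_sum]
  simp only [key, Fintype.sum_option, φ]

end Main

end HilbertMod

theorem mainTheorem9 {B C E F : Type*}
    [CStarAlgebra B] [PartialOrder B] [StarOrderedRing B]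
    [NonUnitalCStarAlgebra C] [PartialOrder C] [StarOrderedRing C]
    [NormedAddCommGroup E] [NormedSpace ℂ E] [SMul Bᵐᵒᵖ E] [CStarModule Bᵐᵒᵖ E] [CompleteSpace E]
    [NormedAddCommGroup F] [NormedSpace ℂ F] [SMul Cᵐᵒᵖ F] [CStarModule Cᵐᵒᵖ F] [CompleteSpace F]
    (τ : CompletelyPositiveMap B C)
    (θ : HilbertMod.Adjointable Bᵐᵒᵖ E →⋆ₙₐ[ℂ] HilbertMod.Adjointable Cᵐᵒᵖ F)
    (hθ : HilbertMod.IsStrictCPH0Dilation τ θ)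
    (T : E → F) (hT : HilbertMod.DiagramCommutes τ θ T) :
    HilbertMod.IsStrictCPH0Map B C T ∧ HilbertMod.BlockwiseCP τ T θ := by
  have h := hT.blockwiseCP hθ.unital hθ.full
  exact ⟨⟨τ, θ, hθ.strict, hθ.unital, h⟩, h⟩
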